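/- Let $K$ be an abelian group. For a commutative $K$-graded ring $R=\bigoplus_{w\in K}R_w$, a proper graded ideal $\mathfrak p$ is called $K$-prime if for homogeneous $a,b$ with $ab\in\mathfrak p$ one has $a\in\mathfrak p$ or $b\in\mathfrak p$. The affine $K$-graded scheme $\mathrm{Spec}_K(R)$ is the set of $K$-prime ideals of $R$, with the topology whose closed sets are $V(\mathfrak a)=\{\mathfrak p : \mathfrak a\subseteq\mathfrak p\}$ for graded ideals $\mathfrak a$, together with the sheaf of $K$-graded rings whose sections over $\{\mathfrak p: f\notin\mathfrak p\}$ ($f$ homogeneous) are the localization $R_f$. A $K$-graded scheme is a topological space $X$ with a sheaf $\mathcal O_X$ of $K$-graded rings (with degree-preserving restriction maps) that has an open cover by affine $K$-graded schemes $(U,\mathcal O_X|_U)$. Its stalks $\mathcal O_{X,x}$ have a unique maximal graded ideal $\mathfrak m_x$. A $K$-invariant morphism $q:X\to Y$ from a $K$-graded scheme $X$ to a scheme $Y$ is a continuous map together with a morphism of sheaves of rings $\mathcal O_Y\to q_*\mathcal O_X$ with image in degree $0$ such that for each $x\in X$ the preimage of $\mathfrak m_x$ under $\mathcal O_{Y,q(x)}\to\mathcal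 O_{X,x}$ is the maximal ideal $\mathfrak m_{q(x)}$. It is called a good quotient by $K$ if it is affine (i.e. $Y$ is covered by affine open sets $V$ such that $q^{-1}(V)$ is an affine $K$-graded scheme) and the pullback $\mathcal O_Y\to (q_*\mathcal O_X)_0$ to the degree-zero part is an isomorphism. **Proposition.** If $q:X\to Y$ is a good quotient by $K$, then the following hold: 1. $q$ is surjective and closed; 2. if $A_i\subseteq X$, $i\in I$, is any family of closed sets, then $q\left(\bigcap_{i\in I}A_i\right)=\bigcap_{i\in I}q(A_i)$; 3. for every $y\in Y$ the fibre $q^{-1}(y)$ contains a unique element which lies in the closure $\overline{\{z\}}$ of every $z\in q^{-1}(y)$; and $y$ is a closed point of $Y$ if and only if this element is a closed point of $X$. -/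

import Mathlib

open CategoryTheory TopologicalSpace Opposite AlgebraicGeometry

universe w v u

namespace GradedGeometry

/-! ### The graded spectrum of a graded ring -/

section Spectrum

variable {K : Type v} [AddCommGroup K] [DecidableEq K]

/-- A `K`-prime ideal of a `K`-graded ring: a proper graded ideal that satisfies the axiom of a
prime ideal for homogeneous elements. (If `K` has torsion, it need not be a prime ideal.) -/
@[ext]
structure KSpec {R : Type u} [CommRing R] (𝒜 : K → AddSubgroup R) [GradedRing 𝒜] where
  asIdeal : HomogeneousIdeal 𝒜
  ne_top : asIdeal ≠ ⊤
  mem_or_mem : ∀ {a b : R}, SetLike.IsHomogeneousElem 𝒜 a → SetLike.IsHomogeneousElem 𝒜 b →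
    a * b ∈ asIdeal → a ∈ asIdeal ∨ b ∈ asIdeal

namespace KSpec

variable {R : Type u} [CommRing R] {𝒜 : K → AddSubgroup R} [GradedRing 𝒜]

/-- The set `V(I)` of all `K`-prime ideals containing the graded ideal `I`. -/
def zeroLocus (I : HomogeneousIdeal 𝒜) : Set (KSpec 𝒜) := {p | I ≤ p.asIdeal}

theorem zeroLocus_union (I J : HomogeneousIdeal 𝒜) :
    zeroLocus I ∪ zeroLocus J = zeroLocus (I ⊓ J) := by
  ext p
  constructor
  · rintro (h | h)
    · exact (inf_le_left : I ⊓ J ≤ I).trans (show I ≤ p.asIdeal from h)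
    · exact (inf_le_right : I ⊓ J ≤ J).trans (show J ≤ p.asIdeal from h)
  · intro h
    by_contra hcon
    have key : ∀ I : HomogeneousIdeal 𝒜, p ∉ zeroLocus I →
        ∃ a, SetLike.IsHomogeneousElem 𝒜 a ∧ a ∈ I ∧ a ∉ p.asIdeal := by
      intro I hI
      by_contra hno
      push Not at hno
      apply hI
      intro x hx
      classical
      have hx' : ∀ i, (DirectSum.decompose 𝒜 x i : R) ∈ p.asIdeal := fun i =>
        hno _ ⟨i, SetLike.coe_mem _⟩ (I.isHomogeneous i hx)
      rw [← DirectSum.sum_support_decompose 𝒜 x]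
      exact Ideal.sum_mem p.asIdeal.toIdeal fun i _ => hx' i
    obtain ⟨a, ha, haI, hap⟩ := key I fun h' => hcon (Or.inl h')
    obtain ⟨b, hb, hbJ, hbp⟩ := key J fun h' => hcon (Or.inr h')
    have hab : a * b ∈ I ⊓ J :=
      ⟨Ideal.mul_mem_right b I.toIdeal haI, Ideal.mul_mem_left J.toIdeal a hbJ⟩
    rcases p.mem_or_mem ha hb (h hab) with h' | h'
    · exact hap h'
    · exact hbp h'

/-- The topology on the `K`-spectrum whose closed sets are the sets `V(I)`. -/
instance : TopologicalSpace (KSpec 𝒜) :=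
  TopologicalSpace.ofClosed (Set.range zeroLocus)
    ⟨⊤, Set.eq_empty_iff_forall_notMem.2 fun p hp => p.ne_top (top_le_iff.1 hp)⟩
    (by
      intro S hS
      refine ⟨sSup {I | zeroLocus I ∈ S}, ?_⟩
      ext p
      constructor
      · intro hp Z hZ
        obtain ⟨I, rfl⟩ := hS hZ
        have h1 : I ≤ sSup {I : HomogeneousIdeal 𝒜 | zeroLocus I ∈ S} := le_sSup hZ
        exact h1.trans (show sSup {I : HomogeneousIdeal 𝒜 | zeroLocus I ∈ S} ≤ p.asIdeal from hp)
      · intro hp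
        change sSup {I : HomogeneousIdeal 𝒜 | zeroLocus I ∈ S} ≤ p.asIdeal
        exact sSup_le fun I hI => hp _ hI)
    (by
      rintro _ ⟨I, rfl⟩ _ ⟨J, rfl⟩
      exact ⟨I ⊓ J, (zeroLocus_union I J).symm⟩)

/-- The principal set of all `K`-prime ideals not containing `f`. -/
def basicOpen (𝒜 : K → AddSubgroup R) [GradedRing 𝒜] (f : R) : Set (KSpec 𝒜) :=
  {p | f ∉ p.asIdeal}

theorem isOpen_basicOpen {f : R} (hf : SetLike.IsHomogeneousElem 𝒜 f) :
    IsOpen (basicOpen 𝒜 f) := by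
  refine ⟨⟨Ideal.span {f}, Ideal.homogeneous_span 𝒜 _ (by simpa using hf)⟩, ?_⟩
  symm
  ext p
  change ¬ (f ∉ p.asIdeal) ↔ Ideal.span {f} ≤ p.asIdeal.toIdeal
  rw [Ideal.span_singleton_le_iff_mem, not_not]
  rfl

end KSpec

end Spectrum

/-! ### Graded schemes -/

/-- A topological space with a presheaf of `K`-graded commutative rings: every ring of sections
is `K`-graded and the restriction maps preserve degrees. -/
structure GradedPresheafedSpace (K : Type v) [AddCommGroup K] [DecidableEq K] extends
    PresheafedSpace.{u, u + 1, u} CommRingCat.{u} where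
  grading : ∀ U : Opens carrier, K → AddSubgroup (presheaf.obj (op U))
  gradedRing : ∀ U : Opens carrier, GradedRing (grading U)
  map_mem : ∀ {U V : Opens carrier} (i : U ⟶ V) (w : K) (s : presheaf.obj (op V)),
    s ∈ grading V w → presheaf.map i.op s ∈ grading U w

namespace GradedPresheafedSpace

variable {K : Type v} [AddCommGroup K] [DecidableEq K]

attribute [instance] GradedPresheafedSpace.gradedRing

/-- The presheaf `U ↦ 𝒪(U)_w` of sections of degree `w`. -/
def degreePresheaf (X : GradedPresheafedSpace.{v, u} K) (w : K) :
    TopCat.Presheaf (Type u) X.carrier where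
  obj U := X.grading U.unop w
  map i := TypeCat.ofHom fun s => ⟨X.presheaf.map i s.1, X.map_mem i.unop w s.1 s.2⟩
  map_id U := by
    ext s
    simp
  map_comp i j := by
    ext s
    simp

/-- A section over `U` is restricted to a smaller open set `V`. -/
def restrict (X : GradedPresheafedSpace.{v, u} K) {U V : Opens X.carrier} (h : V ≤ U) :
    X.presheaf.obj (op U) →+* X.presheaf.obj (op V) :=
  (X.presheaf.map (homOfLE h).op).hom

/-- An isomorphism of `(U, 𝒪|_U)` with the affine `K`-graded scheme of a `K`-graded ring `R`.
It consists of a homeomorphism of `U` with the `K`-spectrum of `R` and a degree-preserving ring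
homomorphism `R → 𝒪(U)` that, for every homogeneous `f`, exhibits the ring of sections over the
open set that corresponds to the principal open set of `f` as the localization `R_f`.
(A graded sheaf is determined by its restriction to a basis of the topology; the degree of a
fraction `a / f ^ n` in the graded ring `𝒪(V)` is automatically `deg a - n • deg f`.) -/
structure AffineChart (X : GradedPresheafedSpace.{v, u} K) (U : Opens X.carrier) where
  R : Type u
  [commRing : CommRing R]
  𝒜 : K → AddSubgroup R
  [gradedRing : GradedRing 𝒜]
  homeo : U ≃ₜ KSpec 𝒜
  toSections : R →+* X.presheaf.obj (op U)
  toSections_mem : ∀ (w : K) (a : R), a ∈ 𝒜 w → toSections a ∈ X.grading U w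
  isLocalization : ∀ (f : R), SetLike.IsHomogeneousElem 𝒜 f → ∀ (V : Opens X.carrier) (h : V ≤ U),
    (V : Set X.carrier) = Subtype.val '' (homeo ⁻¹' KSpec.basicOpen 𝒜 f) →
      letI : Algebra R (X.presheaf.obj (op V)) := ((X.restrict h).comp toSections).toAlgebra
      IsLocalization.Away f (X.presheaf.obj (op V))

/-- The open set `U`, with the restriction of the structure sheaf, is an affine `K`-graded
scheme. -/
def IsAffineOpen (X : GradedPresheafedSpace.{v, u} K) (U : Opens X.carrier) : Prop :=
  Nonempty (X.AffineChart U)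

/-- A germ at `x` is homogeneous if it is the germ of a homogeneous section. -/
def IsHomogeneousGerm (X : GradedPresheafedSpace.{v, u} K) (x : X.carrier)
    (t : X.presheaf.stalk x) : Prop :=
  ∃ (U : Opens X.carrier) (hx : x ∈ U) (s : X.presheaf.obj (op U)),
    SetLike.IsHomogeneousElem (X.grading U) s ∧ X.presheaf.germ U x hx s = t

/-- The `K`-maximal ideal of the stalk at `x`, generated by the homogeneous non-units. (In a
`K`-local ring this is the unique maximal element among the proper graded ideals.) -/
noncomputable def maximalIdeal (X : GradedPresheafedSpace.{v, u} K) (x : X.carrier) :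
    Ideal (X.presheaf.stalk x) :=
  Ideal.span {t | X.IsHomogeneousGerm x t ∧ ¬ IsUnit t}

end GradedPresheafedSpace

/-- A `K`-graded scheme: a topological space with a sheaf of `K`-graded rings that is covered by
affine `K`-graded schemes. A presheaf of `K`-graded rings is a sheaf (with respect to the limits
of the category of `K`-graded rings, which are formed degree by degree) if all its homogeneous
parts are sheaves. -/
structure GradedScheme (K : Type v) [AddCommGroup K] [DecidableEq K] extends
    GradedPresheafedSpace.{v, u} K where
  isSheaf : ∀ w : K, (toGradedPresheafedSpace.degreePresheaf w).IsSheaf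
  exists_affine : ∀ x : carrier, ∃ U : Opens carrier,
    x ∈ U ∧ toGradedPresheafedSpace.IsAffineOpen U

/-! ### Good quotients -/

section Quotient

variable {K : Type v} [AddCommGroup K] [DecidableEq K]

/-- A `K`-invariant morphism, i.e. a morphism of graded schemes from a `K`-graded scheme `X` to a
scheme `Y` (which is the same as a `0`-graded scheme): a continuous map together with a morphism of
sheaves of rings `𝒪_Y → q_* 𝒪_X` which has values in degree zero and satisfies the usual condition
on the (graded) maximal ideals of the stalks. -/
structure InvariantMorphism (X : GradedScheme.{v, u} K) (Y : Scheme.{u}) where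
  hom : X.toPresheafedSpace ⟶ Y.toPresheafedSpace
  app_mem : ∀ (V : Opens Y.toPresheafedSpace.carrier) (s : Y.toPresheafedSpace.presheaf.obj (op V)),
    hom.c.app (op V) s ∈ X.grading ((Opens.map hom.base).obj V) 0
  comap_maximalIdeal : ∀ x : X.carrier,
    (X.maximalIdeal x).comap (hom.stalkMap x).hom =
      IsLocalRing.maximalIdeal (Y.presheaf.stalk (hom.base x))

namespace InvariantMorphism

variable {X : GradedScheme.{v, u} K} {Y : Scheme.{u}}

/-- The underlying map of topological spaces. -/
def map (q : InvariantMorphism X Y) : X.carrier → Y := fun x => q.hom.base x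

/-- The inverse image of an open set. -/
def preimage (q : InvariantMorphism X Y) (V : Y.Opens) : Opens X.carrier :=
  (Opens.map q.hom.base).obj V

/-- The pullback homomorphism `𝒪_Y(V) → 𝒪_X(q⁻¹(V))`. -/
def pullback (q : InvariantMorphism X Y) (V : Y.Opens) :
    Γ(Y, V) →+* X.presheaf.obj (op (q.preimage V)) :=
  (q.hom.c.app (op V)).hom

/-- An affine morphism: the target is covered by affine open sets with affine inverse images. -/
def IsAffine (q : InvariantMorphism X Y) : Prop :=
  ∀ y : Y, ∃ V : Y.Opens, y ∈ V ∧ AlgebraicGeometry.IsAffineOpen V ∧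
    X.IsAffineOpen (q.preimage V)

/-- A good quotient by `K`: an affine `K`-invariant morphism such that the pullback
`𝒪_Y → (q_* 𝒪_X)_0` is an isomorphism. -/
structure IsGoodQuotient (q : InvariantMorphism X Y) : Prop where
  isAffine : q.IsAffine
  bijOn_pullback : ∀ V : Y.Opens,
    Set.BijOn (q.pullback V) Set.univ (X.grading (q.preimage V) 0)

end InvariantMorphism

end Quotient

end GradedGeometry

/-! Everything follows from one point over each `y`: an `x` over `y` lying in every closed `C` with
`y` in the closure of `q(C)` (`exists_special_point`). Taking `C` arbitrary gives closedness, a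
family of `C`s the formula for intersections, and `C` the closure of `{z}` the distinguished point
of the fibre. To find `x`, work over an affine `V` containing `y` with affine preimage, the
`K`-spectrum of `R`. The good quotient condition identifies `Γ(Y, V)` with `R₀`, and `y` becomes a
prime `P` of `R₀`. Among the graded ideals of `R` with degree-zero part inside `P` there is a
largest one, and it is `K`-prime (`exists_largest_over`); this is `x`. The bridge to geometry is
that `q(x)` lies in the principal open set of `g` exactly when the pullback of `g` is outside the
ideal of `x` (`map_mem_basicOpen_iff`, `isUnit_germ_iff`). -/

namespace GradedGeometry

/-! ### Graded ideals over a prime of the degree-zero part -/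

namespace KSpec

variable {K : Type v} [AddCommGroup K] [DecidableEq K]
variable {R : Type u} [CommRing R] {𝒜 : K → AddSubgroup R} [GradedRing 𝒜]

theorem coe_decompose_mul_zero_of_left_mem {v : K} {a : R} (ha : a ∈ 𝒜 v) (b : R) :
    (DirectSum.decompose 𝒜 (a * b) 0 : R) = a * DirectSum.decompose 𝒜 b (-v) := by
  rw [← DirectSum.coe_decompose_mul_add_of_left_mem 𝒜 ha, add_neg_cancel]

theorem coe_decompose_mul_zero_of_right_mem {v : K} (a : R) {b : R} (hb : b ∈ 𝒜 (-v)) :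
    (DirectSum.decompose 𝒜 (a * b) 0 : R) = DirectSum.decompose 𝒜 a v * b := by
  rw [← DirectSum.coe_decompose_mul_add_of_right_mem 𝒜 hb, add_neg_cancel]

variable {A : Type u} [CommRing A] (φ : A →+* R) (P : Ideal A)

/-- The largest graded ideal of `R` whose degree-zero part lies over the ideal `P`: it consists of
all `a` such that the degree-zero part of the ideal generated by `a` is contained in `P`. -/
def largestIdealOver : Ideal R where
  carrier := {a | ∀ b, ∃ g ∈ P, φ g = DirectSum.decompose 𝒜 (a * b) 0}
  zero_mem' b := ⟨0, P.zero_mem, by simp⟩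
  add_mem' := by
    intro a a' ha ha' b
    obtain ⟨g, hg, h⟩ := ha b
    obtain ⟨g', hg', h'⟩ := ha' b
    exact ⟨g + g', P.add_mem hg hg', by simp [add_mul, h, h']⟩
  smul_mem' := by
    intro c a ha b
    obtain ⟨g, hg, h⟩ := ha (c * b)
    exact ⟨g, hg, by rw [h, smul_eq_mul, mul_left_comm, mul_assoc, mul_left_comm]⟩

theorem mem_largestIdealOver {a : R} : a ∈ largestIdealOver (𝒜 := 𝒜) φ P ↔
    ∀ b, ∃ g ∈ P, φ g = DirectSum.decompose 𝒜 (a * b) 0 := Iff.rfl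

/-- The degree-zero part of `a_w * b` equals that of `a * b_{-w}`, so the membership test for `a_w`
is an instance of the one for `a`. -/
theorem isHomogeneous_largestIdealOver :
    (largestIdealOver (𝒜 := 𝒜) φ P).IsHomogeneous 𝒜 := by
  intro w a ha b
  obtain ⟨g, hg, h⟩ := ha (DirectSum.decompose 𝒜 b (-w))
  refine ⟨g, hg, h.trans ?_⟩
  rw [coe_decompose_mul_zero_of_left_mem (SetLike.coe_mem _),
    coe_decompose_mul_zero_of_right_mem _ (SetLike.coe_mem _)]

theorem le_largestIdealOver (hrange : ∀ r, r ∈ 𝒜 0 ↔ r ∈ φ.range) (J : HomogeneousIdeal 𝒜) (hJ : ∀ g, φ g ∈ J → g ∈ P) :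
    J.toIdeal ≤ largestIdealOver (𝒜 := 𝒜) φ P := by
  intro a ha b
  obtain ⟨g, hg⟩ := (hrange _).1 (SetLike.coe_mem (DirectSum.decompose 𝒜 (a * b) 0))
  exact ⟨g, hJ g (hg ▸ J.isHomogeneous 0 (J.toIdeal.mul_mem_right b ha)), hg⟩

theorem map_mem_largestIdealOver_iff (hφ : Function.Injective φ)
    (hrange : ∀ r, r ∈ 𝒜 0 ↔ r ∈ φ.range) (g : A) :
    φ g ∈ largestIdealOver (𝒜 := 𝒜) φ P ↔ g ∈ P := by
  have hg0 : φ g ∈ 𝒜 0 := (hrange _).2 ⟨g, rfl⟩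
  constructor
  · intro h
    obtain ⟨g', hg', h'⟩ := h 1
    rw [mul_one, DirectSum.decompose_of_mem_same 𝒜 hg0] at h'
    exact hφ h' ▸ hg'
  · intro hg b
    obtain ⟨c, hc⟩ := (hrange _).1 (SetLike.coe_mem (DirectSum.decompose 𝒜 b 0))
    refine ⟨g * c, P.mul_mem_right c hg, ?_⟩
    rw [coe_decompose_mul_zero_of_left_mem hg0, map_mul, hc, neg_zero]

/-- Over every prime ideal `P` of the degree-zero part of `R` there is a largest `K`-prime ideal;
it contains all graded ideals whose degree-zero part is contained in `P`. -/
theorem exists_largest_over (hφ : Function.Injective φ)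
    (hrange : ∀ r, r ∈ 𝒜 0 ↔ r ∈ φ.range) [hP : P.IsPrime] :
    ∃ m : KSpec 𝒜, (∀ g, φ g ∈ m.asIdeal ↔ g ∈ P) ∧
      ∀ J : HomogeneousIdeal 𝒜, (∀ g, φ g ∈ J → g ∈ P) → J ≤ m.asIdeal := by
  have hmem := map_mem_largestIdealOver_iff (𝒜 := 𝒜) φ P hφ hrange
  -- A homogeneous element outside the ideal has a multiple in degree zero outside `P`; multiplying
  -- two of these reduces `K`-primality to primality of `P`.
  have key : ∀ (v : K) (a : R), a ∈ 𝒜 v → a ∉ largestIdealOver (𝒜 := 𝒜) φ P →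
      ∃ b g, g ∉ P ∧ φ g = a * b := by
    intro v a ha h
    rw [mem_largestIdealOver] at h
    push Not at h
    obtain ⟨b, hb⟩ := h
    obtain ⟨g, hg⟩ := (hrange _).1 (SetLike.coe_mem (DirectSum.decompose 𝒜 (a * b) 0))
    exact ⟨DirectSum.decompose 𝒜 b (-v), g, fun hgP => hb g hgP hg,
      hg.trans (coe_decompose_mul_zero_of_left_mem ha b)⟩
  refine ⟨⟨⟨largestIdealOver (𝒜 := 𝒜) φ P, isHomogeneous_largestIdealOver φ P⟩, ?_, ?_⟩, hmem,
    fun J hJ => le_largestIdealOver φ P hrange J hJ⟩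
  · intro h
    have h1 : (1 : R) ∈ largestIdealOver (𝒜 := 𝒜) φ P := by
      have := congrArg HomogeneousIdeal.toIdeal h
      change largestIdealOver (𝒜 := 𝒜) φ P = ⊤ at this
      rw [this]
      trivial
    rw [← map_one φ, hmem] at h1
    exact hP.one_notMem h1
  · rintro a c ⟨v, ha⟩ ⟨w, hc⟩ hac
    by_contra! hcon
    obtain ⟨b, g, hg, hgb⟩ := key v a ha hcon.1
    obtain ⟨d, g', hg', hgd⟩ := key w c hc hcon.2
    have : φ (g * g') ∈ largestIdealOver (𝒜 := 𝒜) φ P := by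
      rw [map_mul, hgb, hgd, mul_mul_mul_comm]
      exact Ideal.mul_mem_right _ _ hac
    exact (hP.mem_or_mem ((hmem _).1 this)).elim hg hg'

theorem exists_basicOpen_le {W : Set (KSpec 𝒜)} (hW : IsOpen W) {p : KSpec 𝒜} (hp : p ∈ W) :
    ∃ f, SetLike.IsHomogeneousElem 𝒜 f ∧ p ∈ basicOpen 𝒜 f ∧ basicOpen 𝒜 f ⊆ W := by
  obtain ⟨J, hJ⟩ := hW
  have hpJ : ¬ J ≤ p.asIdeal := fun h => by
    have : p ∈ Wᶜ := hJ ▸ h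
    exact this hp
  classical
  by_contra! hno
  refine hpJ fun a ha => ?_
  have ha' : ∀ i, (DirectSum.decompose 𝒜 a i : R) ∈ p.asIdeal := fun i => by
    by_contra hi
    refine hno _ ⟨i, SetLike.coe_mem _⟩ hi fun x hx => ?_
    by_contra hxW
    have : x ∈ zeroLocus J := hJ ▸ hxW
    exact hx (this (J.isHomogeneous i ha))
  rw [← DirectSum.sum_support_decompose 𝒜 a]
  exact Ideal.sum_mem p.asIdeal.toIdeal fun i _ => ha' i

theorem mem_of_pow_mem (p : KSpec 𝒜) {f : R} (hf : SetLike.IsHomogeneousElem 𝒜 f) (n : ℕ)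
    (h : f ^ n ∈ p.asIdeal) : f ∈ p.asIdeal := by
  induction n with
  | zero =>
    rw [pow_zero] at h
    exact (p.ne_top (HomogeneousIdeal.toIdeal_injective ((Ideal.eq_top_iff_one _).2 h))).elim
  | succ n ih =>
    rw [pow_succ] at h
    exact (p.mem_or_mem ⟨_, SetLike.pow_mem_graded n hf.choose_spec⟩ hf h).elim ih id

theorem le_of_specializes {p p' : KSpec 𝒜} (h : p ⤳ p') : p.asIdeal ≤ p'.asIdeal := by
  have : IsClosed (zeroLocus p.asIdeal) := ⟨⟨p.asIdeal, by simp⟩⟩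
  exact h.mem_closed this (show p.asIdeal ≤ p.asIdeal from le_rfl)

instance : T0Space (KSpec 𝒜) where
  t0 _ _ h := KSpec.ext (le_antisymm (le_of_specializes h.specializes)
    (le_of_specializes h.specializes'))

end KSpec

/-! ### Germs and affine charts -/

namespace GradedPresheafedSpace

variable {K : Type v} [AddCommGroup K] [DecidableEq K] {X : GradedPresheafedSpace.{v, u} K}

theorem germ_restrict {U V : Opens X.carrier} (h : V ≤ U) (x : X.carrier) (hx : x ∈ V)
    (s : X.presheaf.obj (op U)) :
    X.presheaf.germ V x hx (X.restrict h s) = X.presheaf.germ U x (h hx) s :=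
  X.presheaf.germ_res_apply (homOfLE h) x hx s

theorem restrict_restrict {U V W : Opens X.carrier} (h : V ≤ U) (h' : W ≤ V)
    (s : X.presheaf.obj (op U)) : X.restrict h' (X.restrict h s) = X.restrict (h'.trans h) s :=
  congr($(X.presheaf.map_comp (homOfLE h).op (homOfLE h').op) s).symm

theorem exists_isUnit_restrict {U : Opens X.carrier} (x : X.carrier) (hx : x ∈ U)
    (s : X.presheaf.obj (op U)) (hs : IsUnit (X.presheaf.germ U x hx s)) :
    ∃ (W : Opens X.carrier) (_ : x ∈ W) (h : W ≤ U), IsUnit (X.restrict h s) := by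
  obtain ⟨t, ht⟩ := hs.exists_right_inv
  obtain ⟨V, hVU, hxV, t, rfl⟩ := X.presheaf.exists_le_germ_eq t hx
  rw [← germ_restrict hVU x hxV, ← map_mul, ← map_one (X.presheaf.germ V x hxV).hom] at ht
  obtain ⟨W, hxW, i, j, h⟩ := X.presheaf.germ_eq x hxV hxV _ _ ht
  refine ⟨W, hxW, i.le.trans hVU, IsUnit.of_mul_eq_one (X.restrict i.le t) ?_⟩
  rw [← restrict_restrict hVU i.le, ← map_mul]
  exact h.trans (map_one (X.presheaf.map j.op).hom)

namespace AffineChart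

variable {U : Opens X.carrier} (c : X.AffineChart U)

attribute [instance] AffineChart.commRing AffineChart.gradedRing

theorem toSections_bijective : Function.Bijective c.toSections := by
  have hU : (U : Set X.carrier) = Subtype.val '' (c.homeo ⁻¹' KSpec.basicOpen c.𝒜 1) := by
    have h1 : KSpec.basicOpen c.𝒜 1 = Set.univ := by
      refine Set.eq_univ_of_forall fun p hp => p.ne_top ?_
      exact HomogeneousIdeal.toIdeal_injective ((Ideal.eq_top_iff_one _).2 hp)
    rw [h1]
    simp
  have := c.isLocalization 1 ⟨0, SetLike.GradedOne.one_mem⟩ U le_rfl hU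
  let : Algebra c.R (X.presheaf.obj (op U)) := ((X.restrict le_rfl).comp c.toSections).toAlgebra
  have hb : Function.Bijective (algebraMap c.R (X.presheaf.obj (op U))) :=
    (IsLocalization.atOne c.R (X.presheaf.obj (op U))).bijective
  have hid : X.restrict (le_refl U) = RingHom.id _ := by
    ext s
    change X.presheaf.map (𝟙 _) s = s
    simp
  rwa [RingHom.algebraMap_toAlgebra, hid, RingHom.id_comp] at hb

/-- A chart is only required to preserve degrees. The converse holds because homogeneous components
map to homogeneous components and `toSections` is injective. -/
theorem mem_zero_of_toSections_mem {a : c.R} (h : c.toSections a ∈ X.grading U 0) :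
    a ∈ c.𝒜 0 := by
  classical
  suffices hs : ∀ w ≠ 0, (DirectSum.decompose c.𝒜 a w : c.R) = 0 by
    have ha : a = DirectSum.decompose c.𝒜 a 0 := by
      conv_lhs => rw [← DirectSum.sum_support_decompose c.𝒜 a]
      refine Finset.sum_eq_single _ (fun w _ hw => hs w hw) fun h => ?_
      simpa using h
    rw [ha]
    exact SetLike.coe_mem _
  have hcomp : ∀ w, c.toSections (DirectSum.decompose c.𝒜 a w) =
      DirectSum.decompose (X.grading U) (c.toSections a) w := by
    intro w
    conv_rhs => rw [← DirectSum.sum_support_decompose c.𝒜 a, map_sum, DirectSum.decompose_sum,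
      DFinsupp.finsetSum_apply, AddSubgroup.val_finsetSum]
    symm
    refine (Finset.sum_eq_single w (fun v _ hv => ?_) fun h => ?_).trans ?_
    · exact DirectSum.decompose_of_mem_ne _ (c.toSections_mem v _ (SetLike.coe_mem _)) hv
    · rw [DFinsupp.notMem_support_iff] at h
      simp [h]
    · exact DirectSum.decompose_of_mem_same _ (c.toSections_mem w _ (SetLike.coe_mem _))
  intro w hw
  refine c.toSections_bijective.1 ?_
  rw [hcomp, DirectSum.decompose_of_mem_ne _ h hw.symm, map_zero]

/-- The open subset of `X` that corresponds to a principal open set of the chart. -/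
def basicOpen {f : c.R} (hf : SetLike.IsHomogeneousElem c.𝒜 f) : Opens X.carrier :=
  ⟨Subtype.val '' (c.homeo ⁻¹' KSpec.basicOpen c.𝒜 f),
    U.2.isOpenMap_subtype_val _ ((KSpec.isOpen_basicOpen hf).preimage c.homeo.continuous)⟩

theorem basicOpen_le {f : c.R} (hf : SetLike.IsHomogeneousElem c.𝒜 f) : c.basicOpen hf ≤ U := by
  rintro _ ⟨x, -, rfl⟩
  exact x.2

theorem mem_basicOpen {f : c.R} (hf : SetLike.IsHomogeneousElem c.𝒜 f) (x : U) :
    x.1 ∈ c.basicOpen hf ↔ f ∉ (c.homeo x).asIdeal := by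
  constructor
  · rintro ⟨y, hy, h⟩
    rwa [← Subtype.ext h]
  · exact fun h => ⟨x, h, rfl⟩

theorem isUnit_germ_iff {f : c.R} (hf : SetLike.IsHomogeneousElem c.𝒜 f) (x : U) :
    IsUnit (X.presheaf.germ U x.1 x.2 (c.toSections f)) ↔ f ∉ (c.homeo x).asIdeal := by
  constructor
  · intro hu hfx
    obtain ⟨W, hxW, hWU, hW⟩ := exists_isUnit_restrict x.1 x.2 _ hu
    obtain ⟨h, hh, hxh, hhW⟩ := KSpec.exists_basicOpen_le
      (W := c.homeo.symm ⁻¹' (Subtype.val ⁻¹' (W : Set X.carrier)))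
      ((W.2.preimage continuous_subtype_val).preimage c.homeo.symm.continuous)
      (p := c.homeo x) (by simpa using hxW)
    have hle : c.basicOpen hh ≤ W := by
      rintro _ ⟨y, hy, rfl⟩
      simpa using hhW hy
    have hloc := c.isLocalization h hh (c.basicOpen hh) (c.basicOpen_le hh) rfl
    let : Algebra c.R (X.presheaf.obj (op (c.basicOpen hh))) :=
      ((X.restrict (c.basicOpen_le hh)).comp c.toSections).toAlgebra
    have hunit : IsUnit (algebraMap c.R (X.presheaf.obj (op (c.basicOpen hh))) f) := by
      have := hW.map (X.restrict hle)
      rwa [restrict_restrict] at this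
    obtain ⟨t, ht⟩ := hunit.exists_right_inv
    obtain ⟨n, a, hna⟩ := IsLocalization.Away.surj h t
    -- An inverse of `f` near the point is a fraction `a / h ^ n`. Clearing denominators makes a
    -- power of `h` a multiple of `f`, while `h` is outside the `K`-prime ideal.
    have heq : algebraMap c.R (X.presheaf.obj (op (c.basicOpen hh))) (h ^ n) =
        algebraMap _ _ (f * a) := by
      rw [map_mul, ← hna, ← mul_assoc, ht, one_mul, map_pow]
    obtain ⟨m, hm⟩ := IsLocalization.Away.exists_of_eq h heq
    have hmem : h ^ m * h ^ n ∈ (c.homeo x).asIdeal := by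
      rw [hm]
      exact Ideal.mul_mem_left _ _ (Ideal.mul_mem_right _ _ hfx)
    rw [← pow_add] at hmem
    exact hxh ((c.homeo x).mem_of_pow_mem hh _ hmem)
  · intro hfx
    have hloc := c.isLocalization f hf (c.basicOpen hf) (c.basicOpen_le hf) rfl
    let : Algebra c.R (X.presheaf.obj (op (c.basicOpen hf))) :=
      ((X.restrict (c.basicOpen_le hf)).comp c.toSections).toAlgebra
    have hunit : IsUnit (algebraMap c.R (X.presheaf.obj (op (c.basicOpen hf))) f) :=
      IsLocalization.Away.algebraMap_isUnit f
    rw [← germ_restrict (c.basicOpen_le hf) x.1 ((c.mem_basicOpen hf x).2 hfx)]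
    exact hunit.map (X.presheaf.germ (c.basicOpen hf) x.1 _).hom

end AffineChart

end GradedPresheafedSpace

/-! ### Separation of points -/

namespace GradedScheme

variable {K : Type v} [AddCommGroup K] [DecidableEq K] (X : GradedScheme.{v, u} K)

theorem eq_of_specializes {x x' : X.carrier} (h : x ⤳ x') (h' : x' ⤳ x) : x = x' := by
  obtain ⟨U, hx', ⟨c⟩⟩ := X.exists_affine x'
  have hx : x ∈ U := h.mem_open U.2 hx'
  have hU : Inseparable (⟨x, hx⟩ : U) ⟨x', hx'⟩ := by
    rw [← Topology.IsInducing.subtypeVal.inseparable_iff]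
    exact h.antisymm h'
  exact congrArg Subtype.val (c.homeo.injective (hU.map c.homeo.continuous).eq)

end GradedScheme

/-! ### Good quotients -/

namespace InvariantMorphism

variable {K : Type v} [AddCommGroup K] [DecidableEq K] {X : GradedScheme.{v, u} K} {Y : Scheme.{u}}
  (q : InvariantMorphism X Y)

/-- Otherwise its preimage would be the whole local ring at `q(x)` instead of the maximal ideal. -/
theorem maximalIdeal_ne_top (q : InvariantMorphism X Y) (x : X.carrier) : X.maximalIdeal x ≠ ⊤ := by
  intro h
  have := q.comap_maximalIdeal x
  rw [h, Ideal.comap_top] at this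
  exact Ideal.IsPrime.ne_top' this.symm

theorem stalkMap_germ_apply (V : Y.Opens) (g : Γ(Y, V)) (x : X.carrier) (hx : q.map x ∈ V) :
    (q.hom.stalkMap x).hom (Y.presheaf.germ V (q.map x) hx g) =
      X.presheaf.germ (q.preimage V) x hx (q.pullback V g) :=
  congr($(PresheafedSpace.stalkMap_germ q.hom V x hx) g)

theorem map_mem_basicOpen_iff (V : Y.Opens) (g : Γ(Y, V)) (x : X.carrier) (hx : q.map x ∈ V) :
    q.map x ∈ Y.basicOpen g ↔
      IsUnit (X.presheaf.germ (q.preimage V) x hx (q.pullback V g)) := by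
  rw [Scheme.mem_basicOpen _ _ _ hx, ← not_iff_not, ← mem_nonunits_iff,
    ← IsLocalRing.mem_maximalIdeal]
  have hmax : Y.presheaf.germ V (q.map x) hx g ∈ IsLocalRing.maximalIdeal _ ↔
      X.presheaf.germ (q.preimage V) x hx (q.pullback V g) ∈ X.maximalIdeal x := by
    rw [← stalkMap_germ_apply, ← Ideal.mem_comap]
    exact (congr(Y.presheaf.germ V (q.map x) hx g ∈ $(q.comap_maximalIdeal x))).to_iff.symm
  rw [hmax]
  constructor
  · intro h hu
    exact q.maximalIdeal_ne_top x (Ideal.eq_top_of_isUnit_mem _ h hu)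
  · intro h
    exact Ideal.subset_span ⟨⟨_, hx, _, ⟨0, q.app_mem V g⟩, rfl⟩, h⟩

variable {q}

/-- Over every point of a good quotient there is a point of the total space that lies in every
closed set whose image has the given point in its closure. -/
theorem IsGoodQuotient.exists_special_point (hq : q.IsGoodQuotient) (y : Y) :
    ∃ x, q.map x = y ∧ ∀ C : Set X.carrier, IsClosed C → y ∈ closure (q.map '' C) → x ∈ C := by
  obtain ⟨V, hyV, hV, ⟨c⟩⟩ := hq.isAffine y
  let e : c.R ≃+* X.presheaf.obj (op (q.preimage V)) :=
    RingEquiv.ofBijective c.toSections c.toSections_bijective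
  let φ : Γ(Y, V) →+* c.R := (e.symm : _ →+* c.R).comp (q.pullback V)
  have hφe : ∀ g, c.toSections (φ g) = q.pullback V g := fun g => e.apply_symm_apply _
  have hbij := hq.bijOn_pullback V
  have hφ : Function.Injective φ :=
    e.symm.injective.comp (Set.injOn_univ.1 hbij.injOn)
  have hφ0 : ∀ g, φ g ∈ c.𝒜 0 := fun g =>
    c.mem_zero_of_toSections_mem (by rw [hφe]; exact q.app_mem V g)
  have hrange : ∀ r, r ∈ c.𝒜 0 ↔ r ∈ φ.range := by
    intro r
    constructor
    · intro hr
      obtain ⟨g, -, hg⟩ := hbij.surjOn (c.toSections_mem 0 r hr)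
      exact ⟨g, c.toSections_bijective.1 ((hφe g).trans hg)⟩
    · rintro ⟨g, rfl⟩
      exact hφ0 g
  have hpt : ∀ (x : q.preimage V) (g : Γ(Y, V)),
      q.map x.1 ∈ Y.basicOpen g ↔ φ g ∉ (c.homeo x).asIdeal := by
    intro x g
    rw [← c.isUnit_germ_iff ⟨0, hφ0 g⟩ x, hφe]
    exact q.map_mem_basicOpen_iff V g x.1 x.2
  let P : Ideal Γ(Y, V) :=
    (IsLocalRing.maximalIdeal (Y.presheaf.stalk y)).comap (Y.presheaf.germ V y hyV).hom
  have hP : ∀ g, g ∈ P ↔ y ∉ Y.basicOpen g := by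
    intro g
    rw [Scheme.mem_basicOpen _ _ _ hyV]
    rfl
  have : P.IsPrime := Ideal.comap_isPrime _ _
  obtain ⟨m, hm, hmax⟩ := KSpec.exists_largest_over φ P hφ hrange
  have hx : q.map (c.homeo.symm m).1 = y := by
    have hiff : ∀ g : Γ(Y, V), q.map (c.homeo.symm m).1 ∈ Y.basicOpen g ↔ y ∈ Y.basicOpen g := by
      intro g
      rw [hpt, c.homeo.apply_symm_apply, hm, hP, not_not]
    have hxV : q.map (c.homeo.symm m).1 ∈ V := (c.homeo.symm m).2
    -- Principal open sets form a basis of `V`, and `Y` is T0.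
    refine (inseparable_iff_forall_isOpen.2 fun O hO => ?_).eq
    constructor
    · intro hxO
      obtain ⟨g, hgO, hg⟩ := hV.exists_basicOpen_le (V := ⟨O, hO⟩) ⟨_, hxO⟩ hxV
      exact hgO ((hiff g).1 hg)
    · intro hyO
      obtain ⟨g, hgO, hg⟩ := hV.exists_basicOpen_le (V := ⟨O, hO⟩) ⟨_, hyO⟩ hyV
      exact hgO ((hiff g).2 hg)
  refine ⟨_, hx, fun C hC hyC => ?_⟩
  obtain ⟨⟨J, hJ⟩⟩ := (hC.preimage continuous_subtype_val).preimage c.homeo.symm.continuous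
  rw [compl_compl] at hJ
  suffices m ∈ KSpec.zeroLocus J by
    rw [hJ] at this
    exact this
  -- By maximality of `m` it suffices that the degree-zero part of `J` lies in `P`. If not, some
  -- principal open set of `g` with `φ g ∈ J` contains `y` and hence meets `q(C)`; but `φ g` lies in
  -- the ideal of every point of `C` over `V`.
  refine hmax J fun g hg => (hP g).2 fun hy => ?_
  obtain ⟨_, hz, z, hzC, rfl⟩ := mem_closure_iff.1 hyC _ (Y.basicOpen g).2 hy
  have hzV : q.map z ∈ V := Y.basicOpen_le g hz
  refine (hpt ⟨z, hzV⟩ g).1 hz ?_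
  have hzJ : c.homeo ⟨z, hzV⟩ ∈ KSpec.zeroLocus J := by
    rw [hJ]
    simpa using hzC
  exact hzJ hg

theorem continuous_map (q : InvariantMorphism X Y) : Continuous q.map :=
  q.hom.base.hom.continuous

theorem IsGoodQuotient.isClosedMap (hq : q.IsGoodQuotient) : IsClosedMap q.map := by
  refine fun C hC => isClosed_of_closure_subset fun y hy => ?_
  obtain ⟨x, rfl, hx⟩ := hq.exists_special_point y
  exact ⟨x, hx C hC hy, rfl⟩

theorem IsGoodQuotient.surjective (hq : q.IsGoodQuotient) : Function.Surjective q.map :=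
  fun y => (hq.exists_special_point y).imp fun _ h => h.1

theorem IsGoodQuotient.image_iInter (hq : q.IsGoodQuotient) {I : Type w} (A : I → Set X.carrier)
    (hA : ∀ i, IsClosed (A i)) : q.map '' (⋂ i, A i) = ⋂ i, q.map '' A i := by
  refine (Set.image_iInter_subset _ _).antisymm fun y hy => ?_
  obtain ⟨x, hxy, hx⟩ := hq.exists_special_point y
  -- The point `x` depends only on `y`, so it serves all `i` at once.
  exact ⟨x, Set.mem_iInter.2 fun i => hx _ (hA i) (subset_closure (Set.mem_iInter.1 hy i)), hxy⟩

theorem IsGoodQuotient.existsUnique_mem_closure (hq : q.IsGoodQuotient) (y : Y) :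
    ∃! x : X.carrier, q.map x = y ∧ ∀ z, q.map z = y → x ∈ closure {z} := by
  obtain ⟨x, hxy, hx⟩ := hq.exists_special_point y
  have hcl : ∀ z, q.map z = y → x ∈ closure {z} := fun z hz =>
    hx _ isClosed_closure (subset_closure ⟨z, subset_closure rfl, hz⟩)
  refine ⟨x, ⟨hxy, hcl⟩, fun x' ⟨hx'y, hx'⟩ => ?_⟩
  exact X.eq_of_specializes (specializes_iff_mem_closure.2 (hcl x' hx'y))
    (specializes_iff_mem_closure.2 (hx' x hxy))

theorem IsGoodQuotient.isClosed_singleton_iff (hq : q.IsGoodQuotient) {y : Y} {x : X.carrier}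
    (hxy : q.map x = y) (hx : ∀ z, q.map z = y → x ∈ closure {z}) :
    IsClosed {y} ↔ IsClosed {x} := by
  constructor
  · intro hy
    refine isClosed_of_closure_subset fun z hz => ?_
    -- The fibre over a closed point is closed, so a specialization of `x` stays in it and in turn
    -- specializes to `x`.
    have hzy : q.map z = y :=
      closure_minimal (t := q.map ⁻¹' {y}) (Set.singleton_subset_iff.2 hxy)
        (hy.preimage q.continuous_map) hz
    exact X.eq_of_specializes (specializes_iff_mem_closure.2 (hx z hzy))
      (specializes_iff_mem_closure.2 hz)
  · intro h
    rw [← hxy, ← Set.image_singleton]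
    exact hq.isClosedMap _ h

end InvariantMorphism

end GradedGeometry

theorem mainTheorem12 {K : Type v} [AddCommGroup K] [DecidableEq K]
    (X : GradedGeometry.GradedScheme.{v, u} K) (Y : AlgebraicGeometry.Scheme.{u})
    (q : GradedGeometry.InvariantMorphism X Y) (hq : q.IsGoodQuotient) :
    (Function.Surjective q.map ∧ IsClosedMap q.map) ∧
    (∀ (I : Type w) (A : I → Set X.carrier), (∀ i, IsClosed (A i)) →
      q.map '' (⋂ i, A i) = ⋂ i, q.map '' A i) ∧
    (∀ y : Y, (∃! x : X.carrier, q.map x = y ∧ ∀ z, q.map z = y → x ∈ closure {z}) ∧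
      ∀ x : X.carrier, (q.map x = y ∧ ∀ z, q.map z = y → x ∈ closure {z}) →
        (IsClosed {y} ↔ IsClosed {x})) := by
  exact ⟨⟨hq.surjective, hq.isClosedMap⟩, fun _ A hA => hq.image_iInter A hA, fun y =>
    ⟨hq.existsUnique_mem_closure y, fun _ hx => hq.isClosed_singleton_iff hx.1 hx.2⟩⟩
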